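/- Let $G$ be a (real, finite-dimensional, Hausdorff, second countable) smooth Lie group with neutral element $e$, and let $Y_1,\dots,Y_d$ be a basis of its Lie algebra, regarded as left-invariant vector fields on $G$. Write $C_c^\infty(G)$ for the space of smooth real-valued functions on $G$ with compact support and $\mathcal F(G)$ for the space of all real-valued functions on $G$. Functions $x_1,\dots,x_d\in C_c^\infty(G)$ are called canonical co-ordinates on an open neighbourhood $U$ of $e$ if $x_i(e)=0$ for all $i$ and $\tau=\exp\big(\sum_{i=1}^d x_i(\tau)Y_i\big)$ for all $\tau\in U$. A Lévy measure on $G$ is a Borel measure $\nu$ on $G\setminus\{e\}$ such that $\int_{U\setminus\{e\}}\sum_{i=1}^d x_i(\tau)^2\,\nu(d\tau)<\infty$ and $\nu(U^c)<\infty$ whenever $x_1,\dots,x_d\in C_c^\infty(G)$ are canonical co-ordinates on an open neighbourhood $U$ of $e$. A Lévy kernel is a family $(\mu(\sigma,\cdot))_{\sigma\in G}$ of Lévy measures on $G$. A linear map $A:C_c^\infty(G)\to\mathcal F(G)$ satisfies the positive maximum principle if, for $f\in C_c^\infty(G)$ and $\sigma\in G$, $f(\sigma)=\sup_{\tau\in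 G}f(\tau)\ge 0$ implies $Af(\sigma)\le 0$. Fix $x_1,\dots,x_d\in C_c^\infty(G)$ that are canonical co-ordinates on some open neighbourhood of $e$, and let $A:C_c^\infty(G)\to\mathcal F(G)$ be a linear map. Then $A$ satisfies the positive maximum principle if and only if there exist functions $c,\,b_i,\,a_{jk}:G\to\mathbb R$ $(1\le i,j,k\le d)$, with $c(\sigma)\ge 0$ and the matrix $a(\sigma)=(a_{jk}(\sigma))$ symmetric and non-negative definite for every $\sigma\in G$, and a Lévy kernel $\mu$, such that for all $f\in C_c^\infty(G)$ and $\sigma\in G$, $$Af(\sigma)=-c(\sigma)f(\sigma)+\sum_{i=1}^d b_i(\sigma)\,Y_if(\sigma)+\sum_{j,k=1}^d a_{jk}(\sigma)\,Y_jY_kf(\sigma)+\int_{G\setminus\{e\}}\Big(f(\sigma\tau)-f(\sigma)-\sum_{i=1}^d x_i(\tau)\,Y_if(\sigma)\Big)\,\mu(\sigma,d\tau).$$ -/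

import Mathlib

open MeasureTheory
open scoped Manifold ContDiff

noncomputable section

/-- The positive maximum principle for a linear operator `A` that is defined on a linear space `D`
of real-valued functions on `X` and takes values in all real-valued functions on `X`:
whenever `f ∈ D` and `f y = sup f ≥ 0`, one has `A f y ≤ 0`. -/
def PositiveMaximumPrinciple {X : Type*} {D : Submodule ℝ (X → ℝ)} (A : D →ₗ[ℝ] (X → ℝ)) : Prop :=
  ∀ (f : D) (y : X), (∀ x, f.1 x ≤ f.1 y) → 0 ≤ f.1 y → A f y ≤ 0

section LieGroups

variable {E : Type*} [NormedAddCommGroup E] [NormedSpace ℝ E]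

/-- The space `C_c^∞(M)` of smooth real-valued functions with compact support on `M`. -/
def smoothCompactlySupported (E : Type*) [NormedAddCommGroup E] [NormedSpace ℝ E]
    (M : Type*) [TopologicalSpace M] [ChartedSpace E M] : Submodule ℝ (M → ℝ) where
  carrier := {f | ContMDiff 𝓘(ℝ, E) 𝓘(ℝ, ℝ) ∞ f ∧ HasCompactSupport f}
  zero_mem' := ⟨contMDiff_const, HasCompactSupport.zero⟩
  add_mem' hf hg := ⟨hf.1.add hg.1, hf.2.add hg.2⟩
  smul_mem' c _ hf := ⟨(contDiff_const_smul c).contMDiff.comp hf.1, hf.2.smul_left (f := fun _ => c)⟩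

variable {G : Type*} [TopologicalSpace G] [ChartedSpace E G] [Group G]

/-- The action `Y f` on functions of the left-invariant vector field determined by the vector
`Y = v` of the Lie algebra: at `g` it is the derivative of `f` in the direction `d(L_g)_e v`. -/
def leftInvariantDeriv (v : GroupLieAlgebra 𝓘(ℝ, E) G) (f : G → ℝ) (g : G) : ℝ :=
  mfderiv 𝓘(ℝ, E) 𝓘(ℝ, ℝ) f g (mulInvariantVectorField v g)

/-- The relation `g = exp v`, for `v` in the Lie algebra of `G`: the integral curve `γ` of the
left-invariant vector field determined by `v` with `γ 0 = e` satisfies `γ 1 = g`. -/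
def IsLieExp (v : GroupLieAlgebra 𝓘(ℝ, E) G) (g : G) : Prop :=
  ∃ γ : ℝ → G, γ 0 = 1 ∧ IsMIntegralCurve (I := 𝓘(ℝ, E)) γ (mulInvariantVectorField v) ∧ γ 1 = g

/-- `x = (x₁, …, x_d)` are functions in `C_c^∞(G)` that are canonical coordinates, with respect to
the basis `Y` of the Lie algebra, on the open neighbourhood `U` of the identity: they vanish at
the identity and `τ = exp (∑ xᵢ(τ) Yᵢ)` for `τ ∈ U`.  (As the `xᵢ` and `exp` are smooth, the
last condition makes `x` a diffeomorphism of `U` onto an open subset of `ℝ^d`.) -/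
structure IsCanonicalCoordinates {d : ℕ} (Y : Module.Basis (Fin d) ℝ (GroupLieAlgebra 𝓘(ℝ, E) G))
    (U : Set G) (x : Fin d → G → ℝ) : Prop where
  isOpen : IsOpen U
  one_mem : (1 : G) ∈ U
  mem_smooth : ∀ i, x i ∈ smoothCompactlySupported E G
  map_one : ∀ i, x i 1 = 0
  exp_eq : ∀ τ ∈ U, IsLieExp (∑ i, x i τ • Y i) τ

/-- `μ` is a Lévy measure on `G`.  A Borel measure on `G \ {e}` is represented as a Borel measure
on `G` that does not charge `e`. -/
structure IsLevyMeasure [MeasurableSpace G] {d : ℕ}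
    (Y : Module.Basis (Fin d) ℝ (GroupLieAlgebra 𝓘(ℝ, E) G)) (μ : Measure G) : Prop where
  measure_one : μ {1} = 0
  lintegral_lt_top : ∀ (U : Set G) (x : Fin d → G → ℝ), IsCanonicalCoordinates Y U x →
    ∫⁻ g in U \ {1}, ENNReal.ofReal (∑ i, x i g ^ 2) ∂μ < ⊤
  measure_compl_lt_top : ∀ (U : Set G) (x : Fin d → G → ℝ), IsCanonicalCoordinates Y U x →
    μ Uᶜ < ⊤

/-- A Lévy kernel on `G`: a family of Lévy measures `μ(σ, ·)`, `σ ∈ G`. -/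
def IsLevyKernel [MeasurableSpace G] {d : ℕ}
    (Y : Module.Basis (Fin d) ℝ (GroupLieAlgebra 𝓘(ℝ, E) G)) (μ : G → Measure G) : Prop :=
  ∀ σ, IsLevyMeasure Y (μ σ)

end LieGroups

end

section LeftInvariant

open Bundle Set Filter Topology

variable {E : Type*} [NormedAddCommGroup E] [NormedSpace ℝ E]
  {G : Type*} [TopologicalSpace G] [ChartedSpace E G] [Group G]

lemma leftInvariantDeriv_add (v w : GroupLieAlgebra 𝓘(ℝ, E) G) (f : G → ℝ) (g : G) :
    leftInvariantDeriv (v + w) f g = leftInvariantDeriv v f g + leftInvariantDeriv w f g := by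
  unfold leftInvariantDeriv
  rw [mulInvariantVectorField_add]
  exact map_add _ _ _

lemma leftInvariantDeriv_smul (c : ℝ) (v : GroupLieAlgebra 𝓘(ℝ, E) G) (f : G → ℝ) (g : G) :
    leftInvariantDeriv (c • v) f g = c * leftInvariantDeriv v f g := by
  unfold leftInvariantDeriv
  rw [mulInvariantVectorField_smul]
  exact map_smul _ _ _

lemma leftInvariantDeriv_sum {ι : Type*} (s : Finset ι) (c : ι → ℝ)
    (v : ι → GroupLieAlgebra 𝓘(ℝ, E) G) (f : G → ℝ) (g : G) :
    leftInvariantDeriv (∑ i ∈ s, c i • v i) f g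
      = ∑ i ∈ s, c i * leftInvariantDeriv (v i) f g := by
  classical
  induction s using Finset.induction_on with
  | empty =>
    have h := leftInvariantDeriv_smul (0 : ℝ) (0 : GroupLieAlgebra 𝓘(ℝ, E) G) f g
    simpa using h
  | insert a s ha ih =>
    rw [Finset.sum_insert ha, Finset.sum_insert ha, leftInvariantDeriv_add,
      leftInvariantDeriv_smul, ih]

/-- Differentiation along an integral curve of a left-invariant vector field. -/
lemma hasDerivAt_comp_of_isMIntegralCurveAt {v : GroupLieAlgebra 𝓘(ℝ, E) G} {f : G → ℝ}
    (hf : ContMDiff 𝓘(ℝ, E) 𝓘(ℝ, ℝ) ∞ f) {γ : ℝ → G} {t : ℝ}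
    (hγ : IsMIntegralCurveAt (I := 𝓘(ℝ, E)) γ (mulInvariantVectorField v) t) :
    HasDerivAt (f ∘ γ) (leftInvariantDeriv v f (γ t)) t := by
  have h := (hf.mdifferentiable (by simp) (γ t)).hasMFDerivAt.comp t hγ.hasMFDerivAt
  let D : E →L[ℝ] ℝ := mfderiv 𝓘(ℝ, E) 𝓘(ℝ, ℝ) f (γ t)
  let V : E := mulInvariantVectorField v (γ t)
  have h' : HasFDerivAt (f ∘ γ) (D ∘L (1 : ℝ →L[ℝ] ℝ).smulRight V) t :=
    hasMFDerivAt_iff_hasFDerivAt.mp h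
  have h2 := h'.hasDerivAt
  rwa [ContinuousLinearMap.comp_apply, ContinuousLinearMap.smulRight_apply,
    one_apply_eq_self, one_smul] at h2

variable [LieGroup 𝓘(ℝ, E) ∞ G]

lemma contMDiff_mulInvariantVectorField_infty (v : GroupLieAlgebra 𝓘(ℝ, E) G) :
    ContMDiff 𝓘(ℝ, E) 𝓘(ℝ, E).tangent ∞
      (fun g : G ↦ (mulInvariantVectorField v g : TangentBundle 𝓘(ℝ, E) G)) := by
  let fg : G → TangentBundle 𝓘(ℝ, E) G := fun g ↦ TotalSpace.mk' E g 0
  have sfg : CMDiff ∞ fg := contMDiff_zeroSection _ _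
  let fv : G → TangentBundle 𝓘(ℝ, E) G := fun _ ↦ TotalSpace.mk' E 1 v
  have sfv : CMDiff ∞ fv := contMDiff_const
  let F₁ : G → (TangentBundle 𝓘(ℝ, E) G × TangentBundle 𝓘(ℝ, E) G) := fun g ↦ (fg g, fv g)
  have S₁ : CMDiff ∞ F₁ := sfg.prodMk sfv
  let F₂ : (TangentBundle 𝓘(ℝ, E) G × TangentBundle 𝓘(ℝ, E) G) →
      TangentBundle (𝓘(ℝ, E).prod 𝓘(ℝ, E)) (G × G) :=
    (equivTangentBundleProd 𝓘(ℝ, E) G 𝓘(ℝ, E) G).symm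
  have S₂ : CMDiff ∞ F₂ := contMDiff_equivTangentBundleProd_symm
  let F₃ : TangentBundle (𝓘(ℝ, E).prod 𝓘(ℝ, E)) (G × G) → TangentBundle 𝓘(ℝ, E) G :=
    tangentMap% (fun (p : G × G) ↦ p.1 * p.2)
  have S₃ : CMDiff ∞ F₃ := by
    apply ContMDiff.contMDiff_tangentMap _ (m := ∞) le_rfl
    exact contMDiff_mul 𝓘(ℝ, E) ∞
  let S := (S₃.comp S₂).comp S₁
  convert! S with g
  · simp [F₁, F₂, F₃, fg, fv]
  · simp only [Function.comp_apply, tangentMap, F₃, F₂, F₁, fg, fv]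
    rw [mfderiv_prod_eq_add_apply ((contMDiff_mul 𝓘(ℝ, E) ∞).mdifferentiableAt (by simp))]
    change _ = (mfderiv 𝓘(ℝ, E) 𝓘(ℝ, E) (fun z : G ↦ z * 1) g : E →L[ℝ] E) (0 : E) +
      (mfderiv 𝓘(ℝ, E) 𝓘(ℝ, E) (fun z : G ↦ g * z) 1 : E →L[ℝ] E) v
    have h0 := map_zero (mfderiv 𝓘(ℝ, E) 𝓘(ℝ, E) (fun z : G ↦ z * 1) g : E →L[ℝ] E)
    exact (zero_add _).symm.trans (congrArg₂ (· + ·) h0.symm rfl)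

lemma contMDiff_leftInvariantDeriv (v : GroupLieAlgebra 𝓘(ℝ, E) G) {f : G → ℝ}
    (hf : ContMDiff 𝓘(ℝ, E) 𝓘(ℝ, ℝ) ∞ f) :
    ContMDiff 𝓘(ℝ, E) 𝓘(ℝ, ℝ) ∞ (leftInvariantDeriv v f) := by
  have h := (hf.contMDiff_tangentMap (m := ∞) le_rfl).comp
    (contMDiff_mulInvariantVectorField_infty v)
  exact contMDiff_snd_tangentBundle_modelSpace ℝ 𝓘(ℝ, ℝ) |>.comp h

lemma leftInvariantDeriv_mem (v : GroupLieAlgebra 𝓘(ℝ, E) G) {f : G → ℝ}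
    (hf : f ∈ smoothCompactlySupported E G) :
    leftInvariantDeriv v f ∈ smoothCompactlySupported E G := by
  refine ⟨contMDiff_leftInvariantDeriv v hf.1, hf.2.mono' fun g hg ↦ ?_⟩
  by_contra h
  apply hg
  have h0 : f =ᶠ[𝓝 g] fun _ ↦ (0 : ℝ) := notMem_tsupport_iff_eventuallyEq.mp h
  unfold leftInvariantDeriv
  rw [h0.mfderiv_eq, mfderiv_const]
  rfl

lemma leftInvariantDeriv_comp_mul_left (v : GroupLieAlgebra 𝓘(ℝ, E) G) {f : G → ℝ}
    (hf : ContMDiff 𝓘(ℝ, E) 𝓘(ℝ, ℝ) ∞ f) (σ τ : G) :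
    leftInvariantDeriv v (fun g ↦ f (σ * g)) τ = leftInvariantDeriv v f (σ * τ) := by
  have hl (a b : G) : MDifferentiableAt 𝓘(ℝ, E) 𝓘(ℝ, E) (fun g : G ↦ a * g) b :=
    (contMDiff_mul_left (I := 𝓘(ℝ, E)) (n := ∞)).mdifferentiable (by simp) b
  unfold leftInvariantDeriv mulInvariantVectorField
  have h1 : mfderiv 𝓘(ℝ, E) 𝓘(ℝ, ℝ) (fun g ↦ f (σ * g)) τ
      = (mfderiv 𝓘(ℝ, E) 𝓘(ℝ, ℝ) f (σ * τ)).comp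
        (mfderiv 𝓘(ℝ, E) 𝓘(ℝ, E) (fun g : G ↦ σ * g) τ) :=
    mfderiv_comp τ (hf.mdifferentiable (by simp) _) (hl σ τ)
  have h2 (p : G) (hp : τ * 1 = p) :
      (mfderiv 𝓘(ℝ, E) 𝓘(ℝ, E) (fun g : G ↦ σ * τ * g) 1 : E →L[ℝ] E)
      = (mfderiv 𝓘(ℝ, E) 𝓘(ℝ, E) (fun g : G ↦ σ * g) p : E →L[ℝ] E).comp
        (mfderiv 𝓘(ℝ, E) 𝓘(ℝ, E) (fun g : G ↦ τ * g) 1 : E →L[ℝ] E) := by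
    subst hp
    refine Eq.trans ?_ (mfderiv_comp (1 : G) (hl σ _) (hl τ 1))
    congr 1
    ext g
    simp [mul_assoc]
  rw [h1]
  exact congrArg (mfderiv 𝓘(ℝ, E) 𝓘(ℝ, ℝ) f (σ * τ) : E →L[ℝ] ℝ)
    (congrArg (fun D : E →L[ℝ] E ↦ D v) (h2 τ (mul_one τ)).symm)

end LeftInvariant

section OneVariable

lemma abs_sub_le_of_hasDerivAt_Icc {g g' : ℝ → ℝ} {M : ℝ}
    (h : ∀ t ∈ Set.Icc (0 : ℝ) 1, HasDerivAt g (g' t) t)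
    (hM : ∀ t ∈ Set.Icc (0 : ℝ) 1, |g' t| ≤ M) {t : ℝ} (ht : t ∈ Set.Icc (0 : ℝ) 1) :
    |g t - g 0| ≤ M := by
  have h1 := Convex.norm_image_sub_le_of_norm_hasDerivWithin_le (f := g) (f' := g') (C := M)
    (s := Set.Icc (0 : ℝ) 1) (fun t ht ↦ (h t ht).hasDerivWithinAt) hM (convex_Icc 0 1)
    (x := 0) (y := t) (by simp) ht
  have hM0 : 0 ≤ M := (abs_nonneg _).trans (hM 0 (by simp))
  rw [Real.norm_eq_abs, Real.norm_eq_abs, sub_zero, abs_of_nonneg ht.1] at h1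
  exact h1.trans (mul_le_of_le_one_right hM0 ht.2)

/-- A Taylor estimate of third order on the unit interval. -/
lemma abs_taylor_two_le {g₀ g₁ g₂ g₃ : ℝ → ℝ} {M : ℝ} (h₀ : ∀ t, HasDerivAt g₀ (g₁ t) t)
    (h₁ : ∀ t, HasDerivAt g₁ (g₂ t) t) (h₂ : ∀ t, HasDerivAt g₂ (g₃ t) t)
    (hM : ∀ t, |g₃ t| ≤ M) : |g₀ 1 - g₀ 0 - g₁ 0 - g₂ 0 / 2| ≤ M := by
  have b₂ : ∀ t ∈ Set.Icc (0 : ℝ) 1, |g₂ t - g₂ 0| ≤ M := fun t ht ↦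
    abs_sub_le_of_hasDerivAt_Icc (fun t _ ↦ h₂ t) (fun t _ ↦ hM t) ht
  have b₁ : ∀ t ∈ Set.Icc (0 : ℝ) 1, |g₁ t - g₁ 0 - g₂ 0 * t| ≤ M := fun t ht ↦ by
    have := abs_sub_le_of_hasDerivAt_Icc (g := fun t ↦ g₁ t - g₂ 0 * t)
      (g' := fun t ↦ g₂ t - g₂ 0)
      (fun t _ ↦ by simpa using! (h₁ t).sub ((hasDerivAt_id t).const_mul (g₂ 0))) b₂ ht
    convert this using 2
    ring
  have := abs_sub_le_of_hasDerivAt_Icc (g := fun t ↦ g₀ t - g₁ 0 * t - g₂ 0 * t ^ 2 / 2)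
    (g' := fun t ↦ g₁ t - g₁ 0 - g₂ 0 * t)
    (fun t _ ↦ by
      refine (((h₀ t).sub ((hasDerivAt_id t).const_mul (g₁ 0))).sub
        ((((hasDerivAt_id t).pow 2).const_mul (g₂ 0)).div_const 2)).congr_deriv ?_
      simp only [id]
      norm_num
      ring) b₁ (t := 1) (by simp)
  convert this using 2
  ring

/-- The second derivative is nonpositive at a local maximum. -/
lemma IsLocalMax.second_deriv_nonpos {g g' : ℝ → ℝ} {t c : ℝ} (hmax : IsLocalMax g t)
    (hg : ∀ᶠ s in nhds t, HasDerivAt g (g' s) s) (hg' : HasDerivAt g' c t) : c ≤ 0 := by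
  by_contra! hc
  have hd : deriv g =ᶠ[nhds t] g' := hg.mono fun s hs ↦ hs.deriv
  have h2 : deriv (deriv g) t = c := by rw [hd.deriv_eq, hg'.deriv]
  have hmin : IsLocalMin g t := isLocalMin_of_deriv_deriv_pos (h2 ▸ hc) hmax.deriv_eq_zero
    hg.self_of_nhds.continuousAt
  have hconst : g =ᶠ[nhds t] fun _ ↦ g t := by
    filter_upwards [hmin, hmax] with s h1 h2 using le_antisymm h2 h1
  have h3 : deriv g =ᶠ[nhds t] fun _ ↦ 0 := by
    filter_upwards [hconst.eventuallyEq_nhds] with s hs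
    rw [hs.deriv_eq, deriv_const]
  rw [h3.deriv_eq, deriv_const] at h2
  exact hc.ne h2

end OneVariable

section Taylor

open Set Filter Topology

variable {E : Type*} [NormedAddCommGroup E] [NormedSpace ℝ E]
  {G : Type*} [TopologicalSpace G] [ChartedSpace E G] [Group G]

lemma smoothCompactlySupported.exists_bound {f : G → ℝ} (hf : f ∈ smoothCompactlySupported E G) :
    ∃ C, 0 ≤ C ∧ ∀ g, |f g| ≤ C := by
  obtain ⟨C, hC⟩ := hf.1.continuous.bounded_above_of_compact_support hf.2
  exact ⟨C, (norm_nonneg _).trans (hC 1), hC⟩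

lemma abs_le_sqrt_sum_sq {ι : Type*} [Fintype ι] (a : ι → ℝ) (i : ι) :
    |a i| ≤ √(∑ j, a j ^ 2) :=
  Real.abs_le_sqrt (Finset.single_le_sum (f := fun j ↦ a j ^ 2) (fun _ _ ↦ sq_nonneg _)
    (Finset.mem_univ i))

variable {d : ℕ} (Y : Fin d → GroupLieAlgebra 𝓘(ℝ, E) G)

lemma hasDerivAt_comp_curve {a : Fin d → ℝ} {f : G → ℝ}
    (hf : ContMDiff 𝓘(ℝ, E) 𝓘(ℝ, ℝ) ∞ f) {γ : ℝ → G} {t : ℝ}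
    (hγ : IsMIntegralCurveAt (I := 𝓘(ℝ, E)) γ (mulInvariantVectorField (∑ i, a i • Y i)) t) :
    HasDerivAt (fun s ↦ f (γ s)) (∑ i, a i * leftInvariantDeriv (Y i) f (γ t)) t := by
  rw [← leftInvariantDeriv_sum]
  exact hasDerivAt_comp_of_isMIntegralCurveAt hf hγ

/-- First order Taylor estimate along the exponential map. -/
lemma exists_abs_sub_le_of_isLieExp [LieGroup 𝓘(ℝ, E) ∞ G] {f : G → ℝ}
    (hf : f ∈ smoothCompactlySupported E G) :
    ∃ C, 0 ≤ C ∧ ∀ (a : Fin d → ℝ) (τ : G), IsLieExp (∑ i, a i • Y i) τ →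
      |f τ - f 1| ≤ C * √(∑ i, a i ^ 2) := by
  choose C hC0 hC using fun i ↦
    smoothCompactlySupported.exists_bound (leftInvariantDeriv_mem (Y i) hf)
  refine ⟨∑ i, C i, Finset.sum_nonneg fun i _ ↦ hC0 i, ?_⟩
  rintro a τ ⟨γ, h0, hγ, rfl⟩
  have := abs_sub_le_of_hasDerivAt_Icc (g := fun s ↦ f (γ s))
    (fun t _ ↦ hasDerivAt_comp_curve Y hf.1 (hγ.isMIntegralCurveAt t))
    (M := (∑ i, C i) * √(∑ i, a i ^ 2)) (fun t _ ↦ ?_) (t := 1) (by simp)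
  · simpa only [h0] using this
  · rw [Finset.sum_mul]
    refine (Finset.abs_sum_le_sum_abs _ _).trans (Finset.sum_le_sum fun i _ ↦ ?_)
    rw [abs_mul, mul_comm]
    exact mul_le_mul (hC i _) (abs_le_sqrt_sum_sq a i) (abs_nonneg _) (hC0 i)

/-- Third order Taylor estimate along the exponential map. -/
lemma exists_abs_taylor_le_of_isLieExp [LieGroup 𝓘(ℝ, E) ∞ G] {f : G → ℝ}
    (hf : f ∈ smoothCompactlySupported E G) :
    ∃ C, 0 ≤ C ∧ ∀ (a : Fin d → ℝ) (τ : G), IsLieExp (∑ i, a i • Y i) τ →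
      |f τ - f 1 - ∑ i, a i * leftInvariantDeriv (Y i) f 1
        - (∑ j, ∑ k, a j * a k * leftInvariantDeriv (Y j) (leftInvariantDeriv (Y k) f) 1) / 2|
      ≤ C * √(∑ i, a i ^ 2) ^ 3 := by
  have m1 (k) := leftInvariantDeriv_mem (Y k) hf
  have m2 (j k) := leftInvariantDeriv_mem (Y j) (m1 k)
  choose C hC0 hC using fun i j k ↦
    smoothCompactlySupported.exists_bound (leftInvariantDeriv_mem (Y i) (m2 j k))
  refine ⟨∑ j, ∑ k, ∑ i, C i j k, Finset.sum_nonneg fun i _ ↦ Finset.sum_nonneg fun j _ ↦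
    Finset.sum_nonneg fun k _ ↦ hC0 _ _ _, ?_⟩
  rintro a τ ⟨γ, h0, hγ, rfl⟩
  have key := abs_taylor_two_le (g₀ := fun s ↦ f (γ s))
    (g₃ := fun t ↦ ∑ k, a k * ∑ j, a j * ∑ i, a i *
      leftInvariantDeriv (Y i) (leftInvariantDeriv (Y j) (leftInvariantDeriv (Y k) f)) (γ t))
    (fun t ↦ hasDerivAt_comp_curve Y hf.1 (hγ.isMIntegralCurveAt t))
    (fun t ↦ HasDerivAt.fun_sum fun k _ ↦
      (hasDerivAt_comp_curve Y (m1 k).1 (hγ.isMIntegralCurveAt t)).const_mul (a k))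
    (fun t ↦ HasDerivAt.fun_sum fun k _ ↦ .const_mul (a k) (HasDerivAt.fun_sum fun j _ ↦
      (hasDerivAt_comp_curve Y (m2 j k).1 (hγ.isMIntegralCurveAt t)).const_mul (a j)))
    (M := (∑ j, ∑ k, ∑ i, C i j k) * √(∑ i, a i ^ 2) ^ 3) (fun t ↦ ?_)
  · have e : ∑ j, ∑ k, a j * a k * leftInvariantDeriv (Y j) (leftInvariantDeriv (Y k) f) 1
        = ∑ k, a k * ∑ j, a j * leftInvariantDeriv (Y j) (leftInvariantDeriv (Y k) f) 1 := by
      rw [Finset.sum_comm]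
      refine Finset.sum_congr rfl fun k _ ↦ ?_
      rw [Finset.mul_sum]
      exact Finset.sum_congr rfl fun j _ ↦ by ring
    simp only [h0] at key
    rwa [e]
  · simp only [Finset.mul_sum, Finset.sum_mul]
    rw [Finset.sum_comm]
    refine (Finset.abs_sum_le_sum_abs _ _).trans (Finset.sum_le_sum fun j _ ↦ ?_)
    refine (Finset.abs_sum_le_sum_abs _ _).trans (Finset.sum_le_sum fun k _ ↦ ?_)
    refine (Finset.abs_sum_le_sum_abs _ _).trans (Finset.sum_le_sum fun i _ ↦ ?_)
    have e (i) := abs_le_sqrt_sum_sq a i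
    rw [abs_mul, abs_mul, abs_mul]
    calc _ ≤ √(∑ i, a i ^ 2) * (√(∑ i, a i ^ 2) * (√(∑ i, a i ^ 2) * C i j k)) := by
          gcongr
          exacts [e _, e _, e _, hC _ _ _ _]
      _ = _ := by ring

end Taylor

section Maximum

open Set Filter Topology

variable {E : Type*} [NormedAddCommGroup E] [NormedSpace ℝ E] [CompleteSpace E]
  {G : Type*} [TopologicalSpace G] [ChartedSpace E G] [Group G] [LieGroup 𝓘(ℝ, E) ∞ G]

lemma exists_isMIntegralCurveAt_mulInvariantVectorField (v : GroupLieAlgebra 𝓘(ℝ, E) G) (σ : G) :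
    ∃ γ : ℝ → G, γ 0 = σ ∧ IsMIntegralCurveAt (I := 𝓘(ℝ, E)) γ (mulInvariantVectorField v) 0 :=
  have : IsManifold 𝓘(ℝ, E) 1 G := IsManifold.of_le (n := ∞) (by norm_cast)
  exists_isMIntegralCurveAt_of_contMDiffAt_boundaryless 0
    ((contMDiff_mulInvariantVectorField_infty v).of_le (by norm_cast)).contMDiffAt

variable {d : ℕ} (Y : Fin d → GroupLieAlgebra 𝓘(ℝ, E) G) {f : G → ℝ} {σ : G}

lemma leftInvariantDeriv_eq_zero_of_isMax (hf : ContMDiff 𝓘(ℝ, E) 𝓘(ℝ, ℝ) ∞ f)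
    (hmax : ∀ g, f g ≤ f σ) (v : GroupLieAlgebra 𝓘(ℝ, E) G) : leftInvariantDeriv v f σ = 0 := by
  obtain ⟨γ, rfl, hγ⟩ := exists_isMIntegralCurveAt_mulInvariantVectorField v σ
  have hloc : IsLocalMax (f ∘ γ) 0 := Eventually.of_forall fun t ↦ hmax _
  exact hloc.hasDerivAt_eq_zero (hasDerivAt_comp_of_isMIntegralCurveAt hf hγ)

lemma sum_leftInvariantDeriv_nonpos_of_isMax (hf : ContMDiff 𝓘(ℝ, E) 𝓘(ℝ, ℝ) ∞ f)
    (hmax : ∀ g, f g ≤ f σ) (u : Fin d → ℝ) :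
    ∑ j, ∑ k, u j * u k * leftInvariantDeriv (Y j) (leftInvariantDeriv (Y k) f) σ ≤ 0 := by
  obtain ⟨γ, rfl, hγ⟩ :=
    exists_isMIntegralCurveAt_mulInvariantVectorField (∑ i, u i • Y i) σ
  have hloc : IsLocalMax (fun s ↦ f (γ s)) 0 := Eventually.of_forall fun t ↦ hmax _
  have hev : ∀ᶠ s in 𝓝 (0 : ℝ),
      IsMIntegralCurveAt (I := 𝓘(ℝ, E)) γ (mulInvariantVectorField (∑ i, u i • Y i)) s := by
    obtain ⟨s, hs, h⟩ := isMIntegralCurveAt_iff.mp hγ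
    filter_upwards [eventually_mem_nhds_iff.mpr hs] with t ht using h.isMIntegralCurveAt ht
  have := hloc.second_deriv_nonpos (hev.mono fun s hs ↦ hasDerivAt_comp_curve Y hf hs)
    (HasDerivAt.fun_sum fun k _ ↦
      (hasDerivAt_comp_curve Y (contMDiff_leftInvariantDeriv (Y k) hf) hγ).const_mul (u k))
  rw [Finset.sum_comm]
  convert this using 2
  rw [Finset.mul_sum]
  refine Finset.sum_congr rfl fun j _ ↦ ?_
  ring

open scoped MatrixOrder in
lemma sum_posSemidef_mul_nonpos {H a : Matrix (Fin d) (Fin d) ℝ} (ha : a.PosSemidef)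
    (hH : ∀ u : Fin d → ℝ, ∑ j, ∑ k, u j * u k * H j k ≤ 0) : ∑ j, ∑ k, a j k * H j k ≤ 0 := by
  obtain ⟨B, rfl⟩ := CStarAlgebra.nonneg_iff_eq_star_mul_self.mp ha.nonneg
  have : ∑ j, ∑ k, (star B * B) j k * H j k = ∑ m, ∑ j, ∑ k, B m j * B m k * H j k := by
    simp only [Matrix.mul_apply, Matrix.star_apply, star_trivial, Finset.sum_mul]
    refine (Finset.sum_congr rfl fun j _ ↦ Finset.sum_comm).trans Finset.sum_comm
  rw [this]
  exact Finset.sum_nonpos fun m _ ↦ hH (B m)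

end Maximum

section Cutoff

/-- A smooth function of `s` that vanishes for `s ≤ ε` and equals `1` for `s ≥ 2 * ε`. -/
noncomputable def smoothCutoff (ε s : ℝ) : ℝ := Real.smoothTransition (s / ε - 1)

variable {ε s : ℝ}

lemma smoothCutoff_nonneg : 0 ≤ smoothCutoff ε s := Real.smoothTransition.nonneg _

lemma smoothCutoff_le_one : smoothCutoff ε s ≤ 1 := Real.smoothTransition.le_one _

lemma smoothCutoff_eq_zero (hε : 0 < ε) (h : s ≤ ε) : smoothCutoff ε s = 0 :=
  Real.smoothTransition.zero_of_nonpos (by rw [sub_nonpos, div_le_one hε]; exact h)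

lemma smoothCutoff_eq_one (hε : 0 < ε) (h : 2 * ε ≤ s) : smoothCutoff ε s = 1 :=
  Real.smoothTransition.one_of_one_le (by rw [le_sub_iff_add_le, le_div_iff₀ hε]; linarith)

lemma contDiff_smoothCutoff (ε : ℝ) : ContDiff ℝ ∞ (smoothCutoff ε) :=
  Real.smoothTransition.contDiff.comp ((contDiff_id.div_const ε).sub contDiff_const)

lemma contDiff_smoothCutoff_div (hε : 0 < ε) : ContDiff ℝ ∞ fun s ↦ smoothCutoff ε s / s := by
  rw [contDiff_iff_contDiffAt]
  intro s
  rcases lt_or_ge s ε with h | h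
  · refine (contDiffAt_const (c := (0 : ℝ))).congr_of_eventuallyEq ?_
    filter_upwards [gt_mem_nhds h] with t ht
    rw [smoothCutoff_eq_zero hε (le_of_lt ht), zero_div]
  · exact (contDiff_smoothCutoff ε).contDiffAt.div contDiffAt_id (hε.trans_le h).ne'

end Cutoff

section SmoothFunctions

open Set Filter Topology

variable {E : Type*} [NormedAddCommGroup E] [NormedSpace ℝ E]
  {M : Type*} [TopologicalSpace M] [ChartedSpace E M]

lemma smoothCompactlySupported.mul_mem {h f : M → ℝ} (hh : ContMDiff 𝓘(ℝ, E) 𝓘(ℝ, ℝ) ∞ h)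
    (hf : f ∈ smoothCompactlySupported E M) :
    (fun g ↦ h g * f g) ∈ smoothCompactlySupported E M :=
  ⟨hh.mul hf.1, hf.2.mul_left⟩

/-- Multiplication by a smooth function, as a linear map on `C_c^∞(M)`. -/
def smoothCompactlySupported.mulLeft (h : M → ℝ) (hh : ContMDiff 𝓘(ℝ, E) 𝓘(ℝ, ℝ) ∞ h) :
    smoothCompactlySupported E M →ₗ[ℝ] smoothCompactlySupported E M where
  toFun f := ⟨fun g ↦ h g * f.1 g, mul_mem hh f.2⟩
  map_add' f₁ f₂ := by ext g; simp [mul_add]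
  map_smul' c f := by ext g; simp [mul_left_comm]

variable [FiniteDimensional ℝ E] [T2Space M] [SecondCountableTopology M] [IsManifold 𝓘(ℝ, E) ∞ M]

lemma exists_smooth_bump {K U : Set M} (hK : IsCompact K) (hU : IsOpen U) (hKU : K ⊆ U) :
    ∃ χ ∈ smoothCompactlySupported E M, (∀ g, 0 ≤ χ g) ∧ (∀ g, χ g ≤ 1) ∧ (∀ g ∈ K, χ g = 1) ∧
      tsupport χ ⊆ U := by
  have : LocallyCompactSpace M := ChartedSpace.locallyCompactSpace E M
  obtain ⟨V, hV, hKV, hVU, hVc⟩ := exists_open_between_and_isCompact_closure hK hU hKU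
  obtain ⟨χ, hχ, hr, hs, h1⟩ := exists_contMDiff_support_eq_eq_one_iff 𝓘(ℝ, E) (n := ⊤)
    hV hK.isClosed hKV
  have ht : tsupport χ = closure V := by rw [tsupport, hs]
  exact ⟨χ, ⟨hχ, by rwa [HasCompactSupport, ht]⟩, fun g ↦ (hr (mem_range_self g)).1,
    fun g ↦ (hr (mem_range_self g)).2, fun g hg ↦ (h1 g).1 hg, ht ▸ hVU⟩

variable [MeasurableSpace M] [BorelSpace M]

open CompactlySupported in
/-- The Riesz representation theorem for positive functionals on `C_c^∞(M)`. -/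
theorem exists_measure_of_nonneg (L : smoothCompactlySupported E M →ₗ[ℝ] ℝ)
    (hL : ∀ f : smoothCompactlySupported E M, (∀ g, 0 ≤ f.1 g) → 0 ≤ L f) :
    ∃ ρ : Measure M, IsFiniteMeasureOnCompacts ρ ∧
      ∀ f : smoothCompactlySupported E M, ∫ g, f.1 g ∂ρ = L f := by
  have : LocallyCompactSpace M := ChartedSpace.locallyCompactSpace E M
  let D : Submodule ℝ C_c(M, ℝ) :=
    { carrier := {F | (F : M → ℝ) ∈ smoothCompactlySupported E M}
      zero_mem' := (smoothCompactlySupported E M).zero_mem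
      add_mem' := fun h₁ h₂ ↦ (smoothCompactlySupported E M).add_mem h₁ h₂
      smul_mem' := fun c _ h ↦ (smoothCompactlySupported E M).smul_mem c h }
  let ι : D →ₗ[ℝ] smoothCompactlySupported E M :=
    { toFun := fun F ↦ ⟨F.1, F.2⟩
      map_add' := fun _ _ ↦ rfl
      map_smul' := fun _ _ ↦ rfl }
  let s : PointedCone ℝ C_c(M, ℝ) :=
    { carrier := {F | ∀ g, 0 ≤ F g}
      zero_mem' := fun _ ↦ le_rfl
      add_mem' := fun h₁ h₂ g ↦ add_nonneg (h₁ g) (h₂ g)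
      smul_mem' := fun c _ h g ↦ mul_nonneg c.2 (h g) }
  obtain ⟨Λ, hΛ, hpos⟩ := riesz_extension s ⟨D, L ∘ₗ ι⟩ (fun F hF ↦ hL _ hF) fun F ↦ by
    obtain ⟨C, hC⟩ := F.continuous.bounded_above_of_compact_support F.hasCompactSupport
    obtain ⟨χ, hχ, h0, -, h1, -⟩ := exists_smooth_bump (E := E) F.hasCompactSupport
      isOpen_univ (subset_univ _)
    have hC0 (g : M) : 0 ≤ C := (norm_nonneg _).trans (hC g)
    have hm := (smoothCompactlySupported E M).smul_mem C hχ
    refine ⟨⟨⟨⟨C • χ, hm.1.continuous⟩, hm.2⟩, hm⟩, fun g ↦ ?_⟩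
    change 0 ≤ C * χ g + F g
    by_cases hg : g ∈ tsupport F
    · have : -C ≤ F g := (abs_le.mp (hC g)).1
      rw [h1 g hg]
      linarith
    · rw [image_eq_zero_of_notMem_tsupport hg]
      simpa using mul_nonneg (hC0 g) (h0 g)
  let Λ' : C_c(M, ℝ) →ₚ[ℝ] ℝ := PositiveLinearMap.mk₀ Λ fun F hF ↦ hpos F hF
  refine ⟨RealRMK.rieszMeasure Λ', inferInstance, fun f ↦ ?_⟩
  exact (RealRMK.integral_rieszMeasure Λ' ⟨⟨f.1, f.2.1.continuous⟩, f.2.2⟩).trans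
    (hΛ ⟨⟨⟨f.1, f.2.1.continuous⟩, f.2.2⟩, f.2⟩)

end SmoothFunctions

section Gauge

open Set Filter Topology

variable {E : Type*} [NormedAddCommGroup E] [NormedSpace ℝ E]
  {M : Type*} [TopologicalSpace M] [ChartedSpace E M]

/-- A bounded smooth function `q ≥ 0` whose only zero is `p` and which is at least `1` outside of a
compact set. -/
structure IsGauge (E : Type*) [NormedAddCommGroup E] [NormedSpace ℝ E] {M : Type*}
    [TopologicalSpace M] [ChartedSpace E M] (p : M) (q : M → ℝ) : Prop where
  contMDiff : ContMDiff 𝓘(ℝ, E) 𝓘(ℝ, ℝ) ∞ q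
  nonneg : ∀ g, 0 ≤ q g
  eq_zero_iff : ∀ g, q g = 0 ↔ g = p
  exists_le : ∃ Q, ∀ g, q g ≤ Q
  exists_compact : ∃ K, IsCompact K ∧ ∀ g ∉ K, 1 ≤ q g

namespace IsGauge

variable {p : M} {q : M → ℝ}

lemma pos (hq : IsGauge E p q) {g : M} (hg : g ≠ p) : 0 < q g :=
  (hq.nonneg g).lt_of_ne fun h ↦ hg ((hq.eq_zero_iff g).1 h.symm)

lemma apply_self (hq : IsGauge E p q) : q p = 0 := (hq.eq_zero_iff p).2 rfl

lemma contMDiff_smoothCutoff (hq : IsGauge E p q) (ε : ℝ) :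
    ContMDiff 𝓘(ℝ, E) 𝓘(ℝ, ℝ) ∞ fun g ↦ smoothCutoff ε (q g) :=
  (_root_.contDiff_smoothCutoff ε).contMDiff.comp hq.contMDiff

lemma contMDiff_smoothCutoff_div (hq : IsGauge E p q) {ε : ℝ} (hε : 0 < ε) :
    ContMDiff 𝓘(ℝ, E) 𝓘(ℝ, ℝ) ∞ fun g ↦ smoothCutoff ε (q g) / q g :=
  (contDiff_smoothCutoff_div hε).contMDiff.comp hq.contMDiff

lemma one_sub_smoothCutoff_mem [T2Space M] (hq : IsGauge E p q) :
    (fun g ↦ 1 - smoothCutoff (1 / 4) (q g)) ∈ smoothCompactlySupported E M := by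
  obtain ⟨K, hK, h1⟩ := hq.exists_compact
  refine ⟨contMDiff_const.sub (hq.contMDiff_smoothCutoff _), HasCompactSupport.intro hK
    fun g hg ↦ ?_⟩
  rw [smoothCutoff_eq_one (by norm_num) (by linarith [h1 g hg]), sub_self]

end IsGauge

section LevyMeasure

variable {p : M} {q : M → ℝ} [MeasurableSpace M]

/-- The measure `q⁻¹ ρ` on the complement of the point `p`. -/
noncomputable def gaugeMeasure (ρ : Measure M) (p : M) (q : M → ℝ) : Measure M :=
  (ρ.restrict {p}ᶜ).withDensity fun g ↦ ((q g)⁻¹.toNNReal : ENNReal)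

variable [BorelSpace M]

lemma IsGauge.measurable_inv (hq : IsGauge E p q) : Measurable fun g ↦ (q g)⁻¹.toNNReal :=
  hq.contMDiff.continuous.measurable.inv.real_toNNReal

lemma IsGauge.tendsto_integral_smoothCutoff_mul (hq : IsGauge E p q) {μ : Measure M}
    (hμ : μ {p} = 0) {f : M → ℝ} (hf : Integrable f μ) :
    Tendsto (fun n : ℕ ↦ ∫ g, smoothCutoff (1 / ((n : ℝ) + 1)) (q g) * f g ∂μ) atTop
      (𝓝 (∫ g, f g ∂μ)) := by
  refine tendsto_integral_of_dominated_convergence (fun g ↦ ‖f g‖) (fun n ↦ ?_) hf.norm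
    (fun n ↦ Eventually.of_forall fun g ↦ ?_) ?_
  · exact (hq.contMDiff_smoothCutoff _).continuous.aestronglyMeasurable.mul hf.1
  · rw [norm_mul, Real.norm_eq_abs, abs_of_nonneg smoothCutoff_nonneg]
    exact mul_le_of_le_one_left (norm_nonneg _) smoothCutoff_le_one
  · filter_upwards [measure_eq_zero_iff_ae_notMem.1 hμ] with g hg
    refine tendsto_const_nhds.congr' ?_
    have h := (tendsto_one_div_add_atTop_nhds_zero_nat (𝕜 := ℝ)).eventually
      (gt_mem_nhds (half_pos (hq.pos hg)))
    filter_upwards [h] with n hn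
    rw [smoothCutoff_eq_one Nat.one_div_pos_of_nat (by linarith), one_mul]

lemma IsGauge.integral_gaugeMeasure (hq : IsGauge E p q) (ρ : Measure M) (ε : ℝ)
    (f : M → ℝ) : ∫ g, smoothCutoff ε (q g) * f g ∂(gaugeMeasure ρ p q)
      = ∫ g, smoothCutoff ε (q g) / q g * f g ∂ρ := by
  unfold gaugeMeasure
  rw [integral_withDensity_eq_integral_smul hq.measurable_inv,
    ← setIntegral_eq_integral_of_forall_compl_eq_zero (s := {p}ᶜ) (μ := ρ)
      (f := fun g ↦ smoothCutoff ε (q g) / q g * f g)]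
  · congr 1 with g
    rw [NNReal.smul_def, Real.coe_toNNReal _ (inv_nonneg.2 (hq.nonneg g)), smul_eq_mul]
    ring
  · intro g hg
    rw [notMem_compl_iff, mem_singleton_iff] at hg
    simp [hg, hq.apply_self]

variable [T2Space M]

lemma gaugeMeasure_singleton (ρ : Measure M) : gaugeMeasure ρ p q {p} = 0 := by
  refine withDensity_absolutelyContinuous _ _ ?_
  rw [Measure.restrict_apply (measurableSet_singleton p)]
  simp

lemma IsGauge.integrable_gaugeMeasure (hq : IsGauge E p q) (ρ : Measure M)
    [IsFiniteMeasureOnCompacts ρ] {f : M → ℝ} (hf : Continuous f) (hc : HasCompactSupport f)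
    {C : ℝ} (hC : ∀ g, |f g| ≤ C * q g) : Integrable f (gaugeMeasure ρ p q) := by
  unfold gaugeMeasure
  rw [integrable_withDensity_iff_integrable_smul hq.measurable_inv]
  refine Integrable.mono' (g := (tsupport f).indicator fun _ ↦ |C|) ?_ ?_ ?_
  · exact ((integrable_indicator_iff (isClosed_tsupport f).measurableSet).2
      (integrableOn_const hc.isCompact.measure_lt_top.ne)).restrict
  · exact (hq.measurable_inv.smul hf.measurable).aestronglyMeasurable
  · refine (ae_restrict_mem (measurableSet_singleton p).compl).mono fun g hg ↦ ?_
    have hpos := hq.pos hg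
    rw [NNReal.smul_def, Real.coe_toNNReal _ (inv_nonneg.2 (hq.nonneg g)), smul_eq_mul]
    by_cases hs : g ∈ tsupport f
    · rw [indicator_of_mem hs, norm_mul, Real.norm_eq_abs, Real.norm_eq_abs,
        abs_of_pos (inv_pos.2 hpos), inv_mul_le_iff₀ hpos]
      refine (hC g).trans ?_
      rw [mul_comm]
      gcongr
      exact le_abs_self C
    · rw [indicator_of_notMem hs, image_eq_zero_of_notMem_tsupport hs]
      simp

end LevyMeasure

section LocalFunctional

variable {p : M} {q : M → ℝ} {B : smoothCompactlySupported E M →ₗ[ℝ] ℝ}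

lemma le_of_positiveMaximumPrinciple_at
    (hB : ∀ f : smoothCompactlySupported E M, (∀ g, f.1 g ≤ f.1 p) → 0 ≤ f.1 p → B f ≤ 0)
    {f₁ f₂ : smoothCompactlySupported E M} (hle : ∀ g, f₁.1 g ≤ f₂.1 g) (hp : f₁.1 p = f₂.1 p) :
    B f₁ ≤ B f₂ := by
  have h := hB (f₁ - f₂) (fun g ↦ ?_) ?_
  · rwa [map_sub, sub_nonpos] at h
  · simpa [hp] using hle g
  · simp [hp]

variable [MeasurableSpace M] [BorelSpace M] {μ : Measure M}

/-- The functional is at least the integral on nonnegative functions of quadratic growth. -/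
theorem integral_le_of_gaugeMeasure (hq : IsGauge E p q)
    (hB : ∀ f : smoothCompactlySupported E M, (∀ g, f.1 g ≤ f.1 p) → 0 ≤ f.1 p → B f ≤ 0)
    (hμ : μ {p} = 0)
    (hμB : ∀ (ε : ℝ) (_ : 0 < ε) (f : smoothCompactlySupported E M),
        ∫ g, smoothCutoff ε (q g) * f.1 g ∂μ
          = B (smoothCompactlySupported.mulLeft _ (hq.contMDiff_smoothCutoff ε) f))
    {f : smoothCompactlySupported E M} (hf : Integrable f.1 μ) (h0 : ∀ g, 0 ≤ f.1 g)
    (hp : f.1 p = 0) : ∫ g, f.1 g ∂μ ≤ B f := by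
  refine le_of_tendsto (hq.tendsto_integral_smoothCutoff_mul hμ hf)
    (Eventually.of_forall fun n ↦ ?_)
  rw [hμB _ Nat.one_div_pos_of_nat]
  refine le_of_positiveMaximumPrinciple_at hB (fun g ↦ ?_) ?_
  · exact mul_le_of_le_one_left (h0 g) smoothCutoff_le_one
  · change _ * f.1 p = f.1 p
    rw [hp, mul_zero]

/-- The Lévy measure integrates the gauge. -/
theorem integrable_of_gaugeMeasure [T2Space M] (hq : IsGauge E p q)
    (hμi : ∀ (f : M → ℝ) (C : ℝ), Continuous f → HasCompactSupport f → (∀ g, |f g| ≤ C * q g) →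
        Integrable f μ)
    (hθ : Integrable (fun g ↦ smoothCutoff (1 / 4) (q g)) μ) : Integrable q μ := by
  obtain ⟨Q, hQ⟩ := hq.exists_le
  have h1 : Integrable (fun g ↦ (1 - smoothCutoff (1 / 4) (q g)) * q g) μ := by
    refine hμi _ 1 (hq.one_sub_smoothCutoff_mem.1.continuous.mul hq.contMDiff.continuous)
      hq.one_sub_smoothCutoff_mem.2.mul_right fun g ↦ ?_
    rw [abs_mul, abs_of_nonneg (hq.nonneg g)]
    refine mul_le_mul_of_nonneg_right ?_ (hq.nonneg g)
    rw [abs_le]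
    constructor <;> linarith [smoothCutoff_nonneg (ε := 1 / 4) (s := q g),
      smoothCutoff_le_one (ε := 1 / 4) (s := q g)]
  have h2 : Integrable (fun g ↦ smoothCutoff (1 / 4) (q g) * q g) μ :=
    hθ.mul_bdd hq.contMDiff.continuous.aestronglyMeasurable
      (Eventually.of_forall fun g ↦ by
        rw [Real.norm_eq_abs, abs_of_nonneg (hq.nonneg g)]; exact hQ g)
  refine (h1.add h2).congr (Eventually.of_forall fun g ↦ ?_)
  simp only [Pi.add_apply]
  ring

variable [FiniteDimensional ℝ E] [T2Space M] [SecondCountableTopology M] [IsManifold 𝓘(ℝ, E) ∞ M]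

/-- The Lévy measure at `p` of a functional that satisfies the positive maximum principle
at `p`. -/
theorem exists_gaugeMeasure (hq : IsGauge E p q)
    (hB : ∀ f : smoothCompactlySupported E M, (∀ g, f.1 g ≤ f.1 p) → 0 ≤ f.1 p → B f ≤ 0) :
    ∃ μ : Measure M, μ {p} = 0 ∧
      (∀ (f : M → ℝ) (C : ℝ), Continuous f → HasCompactSupport f → (∀ g, |f g| ≤ C * q g) →
        Integrable f μ) ∧
      ∀ (ε : ℝ) (_ : 0 < ε) (f : smoothCompactlySupported E M),
        ∫ g, smoothCutoff ε (q g) * f.1 g ∂μ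
          = B (smoothCompactlySupported.mulLeft _ (hq.contMDiff_smoothCutoff ε) f) := by
  obtain ⟨ρ, hρ, hint⟩ := exists_measure_of_nonneg
    (B ∘ₗ smoothCompactlySupported.mulLeft q hq.contMDiff) fun f hf ↦ by
      rw [← B.map_zero]
      refine le_of_positiveMaximumPrinciple_at hB (fun g ↦ ?_) ?_
      · exact mul_nonneg (hq.nonneg g) (hf g)
      · change 0 = q p * f.1 p
        rw [hq.apply_self, zero_mul]
  refine ⟨gaugeMeasure ρ p q, gaugeMeasure_singleton ρ,
    fun f C h1 h2 h3 ↦ hq.integrable_gaugeMeasure ρ h1 h2 h3, fun ε hε f ↦ ?_⟩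
  rw [hq.integral_gaugeMeasure]
  refine (hint (smoothCompactlySupported.mulLeft _ (hq.contMDiff_smoothCutoff_div hε) f)).trans ?_
  rw [LinearMap.comp_apply]
  congr 1
  ext g
  change q g * (smoothCutoff ε (q g) / q g * f.1 g) = smoothCutoff ε (q g) * f.1 g
  by_cases h0 : q g = 0
  · rw [h0, smoothCutoff_eq_zero hε hε.le]
    simp
  · field_simp

/-- The functional is the integral on functions that are small compared to the gauge. -/
theorem eq_integral_of_gaugeMeasure (hq : IsGauge E p q)
    (hB : ∀ f : smoothCompactlySupported E M, (∀ g, f.1 g ≤ f.1 p) → 0 ≤ f.1 p → B f ≤ 0)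
    (hμ : μ {p} = 0)
    (hμB : ∀ (ε : ℝ) (_ : 0 < ε) (f : smoothCompactlySupported E M),
        ∫ g, smoothCutoff ε (q g) * f.1 g ∂μ
          = B (smoothCompactlySupported.mulLeft _ (hq.contMDiff_smoothCutoff ε) f))
    {f : smoothCompactlySupported E M} (hf : Integrable f.1 μ) {C : ℝ} (hC0 : 0 ≤ C)
    (hC : ∀ g, |f.1 g| ≤ C * (q g * √(q g))) : B f = ∫ g, f.1 g ∂μ := by
  obtain ⟨ψ, hψ, hψ0, -, hψ1, -⟩ := exists_smooth_bump (E := E) f.2.2.isCompact isOpen_univ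
    (subset_univ _)
  let qψ : smoothCompactlySupported E M :=
    smoothCompactlySupported.mulLeft q hq.contMDiff ⟨ψ, hψ⟩
  have key (n : ℕ) : |∫ g, smoothCutoff (1 / ((n : ℝ) + 1)) (q g) * f.1 g ∂μ - B f|
      ≤ C * √(2 * (1 / ((n : ℝ) + 1))) * B qψ := by
    have hε : (0 : ℝ) < 1 / ((n : ℝ) + 1) := Nat.one_div_pos_of_nat
    set ε : ℝ := 1 / ((n : ℝ) + 1)
    rw [hμB _ hε]
    set fε := smoothCompactlySupported.mulLeft _ (hq.contMDiff_smoothCutoff ε) f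
    have hb (g : M) : |fε.1 g - f.1 g| ≤ C * √(2 * ε) * (q g * ψ g) := by
      have e : fε.1 g - f.1 g = (smoothCutoff ε (q g) - 1) * f.1 g := by
        change smoothCutoff ε (q g) * f.1 g - f.1 g = _
        ring
      have hr : 0 ≤ C * √(2 * ε) * (q g * ψ g) :=
        mul_nonneg (mul_nonneg hC0 (Real.sqrt_nonneg _)) (mul_nonneg (hq.nonneg g) (hψ0 g))
      by_cases hs : g ∈ tsupport f.1
      · rcases le_total (2 * ε) (q g) with h | h
        · rwa [e, smoothCutoff_eq_one hε h, sub_self, zero_mul, abs_zero]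
        · rw [e, abs_mul, hψ1 g hs, mul_one]
          calc _ ≤ 1 * (C * (q g * √(q g))) := by
                refine mul_le_mul ?_ (hC g) (abs_nonneg _) zero_le_one
                rw [abs_le]
                constructor <;> linarith [smoothCutoff_nonneg (ε := ε) (s := q g),
                  smoothCutoff_le_one (ε := ε) (s := q g)]
            _ ≤ 1 * (C * (q g * √(2 * ε))) := by
                have := hq.nonneg g
                gcongr
            _ = _ := by ring
      · rwa [e, image_eq_zero_of_notMem_tsupport hs, mul_zero, abs_zero]
    have hp : fε.1 p - f.1 p = 0 := by
      have := hb p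
      rw [hq.apply_self, zero_mul, mul_zero] at this
      exact abs_nonpos_iff.1 this
    rw [← map_sub, ← smul_eq_mul, ← map_smul, abs_le, ← map_neg]
    constructor <;> refine le_of_positiveMaximumPrinciple_at hB (fun g ↦ ?_) ?_
    · exact (abs_le.1 (hb g)).1
    · change -(C * √(2 * ε) * (q p * ψ p)) = fε.1 p - f.1 p
      rw [hp, hq.apply_self]
      simp
    · exact (abs_le.1 (hb g)).2
    · change fε.1 p - f.1 p = C * √(2 * ε) * (q p * ψ p)
      rw [hp, hq.apply_self]
      simp
  have hlim : Tendsto (fun n : ℕ ↦ C * √(2 * (1 / ((n : ℝ) + 1))) * B qψ) atTop (𝓝 0) := by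
    have h := (((tendsto_one_div_add_atTop_nhds_zero_nat (𝕜 := ℝ)).const_mul 2).sqrt.const_mul
      C).mul_const (B qψ)
    simpa using h
  have h1 := (hq.tendsto_integral_smoothCutoff_mul hμ hf).sub_const (B f)
  have h2 := squeeze_zero_norm (fun n ↦ (Real.norm_eq_abs _).trans_le (key n)) hlim
  exact (sub_eq_zero.1 (tendsto_nhds_unique h1 h2)).symm

/-- The total mass bound away from `p`. -/
theorem lintegral_smoothCutoff_le_of_gaugeMeasure (hq : IsGauge E p q)
    (hB : ∀ f : smoothCompactlySupported E M, (∀ g, f.1 g ≤ f.1 p) → 0 ≤ f.1 p → B f ≤ 0)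
    (hμi : ∀ (f : M → ℝ) (C : ℝ), Continuous f → HasCompactSupport f → (∀ g, |f g| ≤ C * q g) →
        Integrable f μ)
    (hμB : ∀ (ε : ℝ) (_ : 0 < ε) (f : smoothCompactlySupported E M),
        ∫ g, smoothCutoff ε (q g) * f.1 g ∂μ
          = B (smoothCompactlySupported.mulLeft _ (hq.contMDiff_smoothCutoff ε) f)) :
    ∫⁻ g, ENNReal.ofReal (smoothCutoff (1 / 4) (q g)) ∂μ
      ≤ ENNReal.ofReal (- B ⟨_, hq.one_sub_smoothCutoff_mem⟩) := by
  have : LocallyCompactSpace M := ChartedSpace.locallyCompactSpace E M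
  let K := CompactExhaustion.choice M
  choose ζ hζ hζ0 hζ1 hζK _ using fun n ↦ exists_smooth_bump (E := E) (K.isCompact n)
    isOpen_univ (subset_univ _)
  have hc : Continuous fun g ↦ smoothCutoff (1 / 4) (q g) :=
    (hq.contMDiff_smoothCutoff (1 / 4)).continuous
  have hcζ (n : ℕ) : Continuous fun g ↦ smoothCutoff (1 / 4) (q g) * ζ n g :=
    hc.mul (hζ n).1.continuous
  have hpt (g : M) : ENNReal.ofReal (smoothCutoff (1 / 4) (q g))
      = liminf (fun n ↦ ENNReal.ofReal (smoothCutoff (1 / 4) (q g) * ζ n g)) atTop := by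
    refine (Tendsto.liminf_eq (tendsto_const_nhds.congr' ?_)).symm
    obtain ⟨n, hn⟩ := K.exists_mem g
    filter_upwards [eventually_ge_atTop n] with m hm
    rw [hζK m g (K.subset hm hn), mul_one]
  simp_rw [hpt]
  refine (lintegral_liminf_le fun n ↦ (hcζ n).measurable.ennreal_ofReal).trans ?_
  refine liminf_le_of_le ⟨0, by simp⟩ fun b hb ↦ ?_
  obtain ⟨n, hn⟩ := hb.exists
  refine hn.trans ?_
  rw [← ofReal_integral_eq_lintegral_ofReal]
  · refine ENNReal.ofReal_le_ofReal ?_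
    rw [hμB (1 / 4) (by norm_num) ⟨ζ n, hζ n⟩, le_neg_iff_add_nonpos_left, ← map_add]
    have hp : smoothCutoff (1 / 4) (q p) = 0 :=
      smoothCutoff_eq_zero (by norm_num) (by rw [hq.apply_self]; norm_num)
    refine hB _ (fun g ↦ ?_) ?_
    · change 1 - smoothCutoff (1 / 4) (q g) + smoothCutoff (1 / 4) (q g) * ζ n g
        ≤ 1 - smoothCutoff (1 / 4) (q p) + smoothCutoff (1 / 4) (q p) * ζ n p
      rw [hp]
      have := mul_le_of_le_one_right (smoothCutoff_nonneg (ε := 1 / 4) (s := q g)) (hζ1 n g)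
      linarith
    · change 0 ≤ 1 - smoothCutoff (1 / 4) (q p) + smoothCutoff (1 / 4) (q p) * ζ n p
      rw [hp]
      norm_num
  · refine hμi _ 4 (hcζ n) (hζ n).2.mul_left fun g ↦ ?_
    rw [abs_of_nonneg (mul_nonneg smoothCutoff_nonneg (hζ0 n g))]
    rcases le_total (q g) (1 / 4) with h | h
    · rw [smoothCutoff_eq_zero (by norm_num) h, zero_mul]
      exact mul_nonneg (by norm_num) (hq.nonneg g)
    · have := mul_le_one₀ (smoothCutoff_le_one (ε := 1 / 4) (s := q g)) (hζ0 n g) (hζ1 n g)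
      linarith
  · exact Eventually.of_forall fun g ↦ mul_nonneg smoothCutoff_nonneg (hζ0 n g)

end LocalFunctional

end Gauge

section CanonicalGauge

open Set Filter Topology

variable {E : Type*} [NormedAddCommGroup E] [NormedSpace ℝ E]
  {G : Type*} [TopologicalSpace G] [ChartedSpace E G] [Group G] [LieGroup 𝓘(ℝ, E) ∞ G] {d : ℕ}
  {Y : Module.Basis (Fin d) ℝ (GroupLieAlgebra 𝓘(ℝ, E) G)} {U : Set G} {x : Fin d → G → ℝ}
  {q : G → ℝ}

lemma IsCanonicalCoordinates.exists_abs_sub_le (hx : IsCanonicalCoordinates Y U x)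
    (hle : ∀ g, ∑ i, x i g ^ 2 ≤ q g) (hU : ∀ g, q g < 1 → g ∈ U)
    {f : G → ℝ} (hf : f ∈ smoothCompactlySupported E G) :
    ∃ C, 0 ≤ C ∧ ∀ g, |f g - f 1| ≤ C * √(q g) := by
  obtain ⟨C, hC0, hC⟩ := exists_abs_sub_le_of_isLieExp Y hf
  obtain ⟨D, hD0, hD⟩ := smoothCompactlySupported.exists_bound hf
  refine ⟨C + 2 * D, by positivity, fun g ↦ ?_⟩
  rcases lt_or_ge (q g) 1 with h | h
  · calc _ ≤ C * √(∑ i, x i g ^ 2) := hC _ g (hx.exp_eq g (hU g h))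
      _ ≤ (C + 2 * D) * √(q g) := by
        gcongr
        · linarith
        · exact hle g
  · have h1 : 1 ≤ √(q g) := Real.one_le_sqrt.2 h
    have h2 : |f g - f 1| ≤ 2 * D := by linarith [abs_sub (f g) (f 1), hD g, hD 1]
    nlinarith [Real.sqrt_nonneg (q g)]

/-- The Taylor remainder of second order in canonical coordinates. -/
lemma IsCanonicalCoordinates.exists_abs_taylor_le (hx : IsCanonicalCoordinates Y U x)
    (hq : IsGauge E 1 q) (hle : ∀ g, ∑ i, x i g ^ 2 ≤ q g) (hU : ∀ g, q g < 1 → g ∈ U)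
    {f R : G → ℝ} (hf : f ∈ smoothCompactlySupported E G)
    (hRm : R ∈ smoothCompactlySupported E G)
    (hR : ∀ g, R g = f g - f 1 * (1 - smoothCutoff (1 / 4) (q g))
      - ∑ i, x i g * leftInvariantDeriv (Y i) f 1
      - (∑ j, ∑ k, x j g * x k g *
        leftInvariantDeriv (Y j) (leftInvariantDeriv (Y k) f) 1) / 2) :
    ∃ C, 0 ≤ C ∧ ∀ g, |R g| ≤ C * (q g * √(q g)) := by
  obtain ⟨C, hC0, hC⟩ := exists_abs_taylor_le_of_isLieExp Y hf
  obtain ⟨D, hD0, hD⟩ := smoothCompactlySupported.exists_bound hRm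
  refine ⟨C + 8 * D, by positivity, fun g ↦ ?_⟩
  have hqg := hq.nonneg g
  rcases le_total (q g) (1 / 4) with h | h
  · have h3 : √(q g) ^ 3 = q g * √(q g) := by
      rw [pow_succ, Real.sq_sqrt hqg]
    have e := hC _ g (hx.exp_eq g (hU g (by linarith)))
    rw [hR, smoothCutoff_eq_zero (by norm_num) h, sub_zero, mul_one, ← h3]
    refine e.trans ?_
    gcongr
    · linarith
    · exact hle g
  · have h1 : 1 / 2 ≤ √(q g) := Real.le_sqrt_of_sq_le (by norm_num; linarith)
    have h2 : 1 / 4 * (1 / 2) ≤ q g * √(q g) := by gcongr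
    have h4 : 0 ≤ q g * √(q g) := by positivity
    nlinarith [hD g]

/-- A measure that integrates the gauge is a Lévy measure. -/
lemma IsCanonicalCoordinates.isLevyMeasure [MeasurableSpace G] {μ : Measure G}
    (hx : IsCanonicalCoordinates Y U x)
    (hq : IsGauge E 1 q) (hle : ∀ g, ∑ i, x i g ^ 2 ≤ q g) (hU : ∀ g, q g < 1 → g ∈ U)
    (hμ : μ {1} = 0) (hi : Integrable q μ) : IsLevyMeasure Y μ where
  measure_one := hμ
  lintegral_lt_top V y hy := by
    choose C hC0 hC using fun i ↦ hx.exists_abs_sub_le hle hU (hy.mem_smooth i)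
    have hb (g : G) : ∑ i, y i g ^ 2 ≤ (∑ i, C i ^ 2) * q g := by
      rw [Finset.sum_mul]
      refine Finset.sum_le_sum fun i _ ↦ ?_
      have h := hC i g
      rw [hy.map_one, sub_zero] at h
      rw [← sq_abs, ← Real.sq_sqrt (hq.nonneg g), ← mul_pow]
      exact pow_le_pow_left₀ (abs_nonneg _) h 2
    calc _ ≤ ∫⁻ g, ENNReal.ofReal (∑ i, y i g ^ 2) ∂μ := setLIntegral_le_lintegral _ _
      _ ≤ ∫⁻ g, ENNReal.ofReal ((∑ i, C i ^ 2) * q g) ∂μ :=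
        lintegral_mono fun g ↦ ENNReal.ofReal_le_ofReal (hb g)
      _ < ⊤ := (hasFiniteIntegral_iff_ofReal (Eventually.of_forall fun g ↦
          mul_nonneg (Finset.sum_nonneg fun i _ ↦ sq_nonneg _) (hq.nonneg g))).1
          (hi.const_mul _).2
  measure_compl_lt_top V y hy := by
    obtain ⟨K, hK, hK1⟩ := hq.exists_compact
    obtain ⟨δ, hδ, hδ1⟩ : ∃ δ > 0, ∀ g ∈ Vᶜ, δ ≤ q g := by
      rcases (Vᶜ ∩ K).eq_empty_or_nonempty with he | hne
      · refine ⟨1, one_pos, fun g hg ↦ hK1 g fun hgK ↦ ?_⟩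
        exact (he ▸ (⟨hg, hgK⟩ : g ∈ Vᶜ ∩ K) : g ∈ (∅ : Set G))
      · obtain ⟨g₀, hg₀, hmin⟩ := (hK.inter_left hy.isOpen.isClosed_compl).exists_isMinOn hne
          hq.contMDiff.continuous.continuousOn
        refine ⟨min 1 (q g₀), lt_min one_pos (hq.pos ?_), fun g hg ↦ ?_⟩
        · rintro rfl
          exact hg₀.1 hy.one_mem
        · by_cases hgK : g ∈ K
          · exact (min_le_right _ _).trans (hmin ⟨hg, hgK⟩)
          · exact (min_le_left _ _).trans (hK1 g hgK)
    exact (measure_mono hδ1).trans_lt (hi.measure_ge_lt_top hδ)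

variable [FiniteDimensional ℝ E] [T2Space G] [SecondCountableTopology G]

/-- Canonical coordinates determine points: only the identity has all coordinates zero. -/
lemma IsCanonicalCoordinates.eq_one (hx : IsCanonicalCoordinates Y U x) {g : G} (hg : g ∈ U)
    (h0 : ∀ i, x i g = 0) : g = 1 := by
  by_contra hne
  obtain ⟨f, hf, -, -, h1, hs⟩ := exists_smooth_bump (E := E) (isCompact_singleton (x := (1 : G)))
    (isOpen_compl_singleton (x := g)) (singleton_subset_iff.2 (Ne.symm hne))
  obtain ⟨C, -, hC⟩ := exists_abs_sub_le_of_isLieExp Y hf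
  have h := hC _ g (hx.exp_eq g hg)
  have hfg : f g = 0 := image_eq_zero_of_notMem_tsupport fun hg ↦ hs hg rfl
  rw [h1 1 rfl, hfg] at h
  simp [h0] at h
  linarith

theorem IsCanonicalCoordinates.exists_gauge (hx : IsCanonicalCoordinates Y U x) :
    ∃ q : G → ℝ, IsGauge E 1 q ∧ (∀ g, ∑ i, x i g ^ 2 ≤ q g) ∧ ∀ g, q g < 1 → g ∈ U := by
  obtain ⟨χ, hχ, h0, h1, hone, hs⟩ := exists_smooth_bump (E := E)
    (isCompact_singleton (x := (1 : G))) hx.isOpen (by simpa using hx.one_mem)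
  have hsum (g : G) : 0 ≤ ∑ i, x i g ^ 2 := Finset.sum_nonneg fun i _ ↦ sq_nonneg _
  have hU (g : G) (hg : χ g ≠ 0) : g ∈ U := hs (subset_tsupport _ hg)
  choose C hC0 hC using fun i ↦ smoothCompactlySupported.exists_bound (hx.mem_smooth i)
  refine ⟨fun g ↦ ∑ i, x i g ^ 2 + (1 - χ g), ⟨?_, fun g ↦ ?_, fun g ↦ ⟨fun h ↦ ?_, ?_⟩, ?_, ?_⟩,
    fun g ↦ ?_, fun g hg ↦ ?_⟩
  · refine ContMDiff.add (contMDiff_finsetSum fun i _ ↦ ?_) (contMDiff_const.sub hχ.1)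
    exact (contDiff_id.pow 2).contMDiff.comp (hx.mem_smooth i).1
  · linarith [hsum g, h1 g]
  · have hx0 : ∑ i, x i g ^ 2 = 0 := by linarith [hsum g, h1 g]
    rw [Finset.sum_eq_zero_iff_of_nonneg fun i _ ↦ sq_nonneg _] at hx0
    exact hx.eq_one (hU g (by linarith [hsum g])) fun i ↦ by
      simpa using hx0 i (Finset.mem_univ i)
  · rintro rfl
    simp [hx.map_one, hone 1 rfl]
  · refine ⟨∑ i, C i ^ 2 + 1, fun g ↦ add_le_add (Finset.sum_le_sum fun i _ ↦ ?_) ?_⟩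
    · exact sq_le_sq' (abs_le.1 (hC i g)).1 (abs_le.1 (hC i g)).2
    · linarith [h0 g]
  · refine ⟨tsupport χ, hχ.2, fun g hg ↦ ?_⟩
    rw [image_eq_zero_of_notMem_tsupport hg]
    linarith [hsum g]
  · linarith [h1 g]
  · refine hU g fun h ↦ ?_
    simp only [h] at hg
    linarith [hsum g]

end CanonicalGauge

section Representation

open Set Filter Topology

variable {E : Type*} [NormedAddCommGroup E] [NormedSpace ℝ E] [FiniteDimensional ℝ E]
  {G : Type*} [TopologicalSpace G] [T2Space G] [SecondCountableTopology G]
  [ChartedSpace E G] [Group G] [LieGroup 𝓘(ℝ, E) ∞ G] [MeasurableSpace G] [BorelSpace G]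
  {d : ℕ} {Y : Module.Basis (Fin d) ℝ (GroupLieAlgebra 𝓘(ℝ, E) G)} {U : Set G}
  {x : Fin d → G → ℝ}

/-- The representation of a functional that satisfies the positive maximum principle at the
identity. -/
theorem IsCanonicalCoordinates.exists_representation_at_one (hx : IsCanonicalCoordinates Y U x)
    {B : smoothCompactlySupported E G →ₗ[ℝ] ℝ}
    (hB : ∀ f : smoothCompactlySupported E G, (∀ g, f.1 g ≤ f.1 1) → 0 ≤ f.1 1 → B f ≤ 0) :
    ∃ (c : ℝ) (b : Fin d → ℝ) (a : Matrix (Fin d) (Fin d) ℝ) (μ : Measure G),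
      0 ≤ c ∧ a.PosSemidef ∧ IsLevyMeasure Y μ ∧ ∀ f : smoothCompactlySupported E G,
        B f = -c * f.1 1 + ∑ i, b i * leftInvariantDeriv (Y i) f.1 1
          + ∑ j, ∑ k, a j k * leftInvariantDeriv (Y j) (leftInvariantDeriv (Y k) f.1) 1
          + ∫ τ in {(1 : G)}ᶜ,
              (f.1 τ - f.1 1 - ∑ i, x i τ * leftInvariantDeriv (Y i) f.1 1) ∂μ := by
  obtain ⟨q, hq, hle, hU⟩ := hx.exists_gauge
  obtain ⟨μ, hμ, hμi, hμB⟩ := exists_gaugeMeasure hq hB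
  have hlint := lintegral_smoothCutoff_le_of_gaugeMeasure hq hB hμi hμB
  set χ : smoothCompactlySupported E G := ⟨_, hq.one_sub_smoothCutoff_mem⟩
  set θ : G → ℝ := fun g ↦ smoothCutoff (1 / 4) (q g)
  have hθ0 : ∀ g, 0 ≤ θ g := fun g ↦ smoothCutoff_nonneg
  have hθm : AEStronglyMeasurable θ μ :=
    (hq.contMDiff_smoothCutoff (1 / 4)).continuous.aestronglyMeasurable
  have hθi : Integrable θ μ := ⟨hθm, (hasFiniteIntegral_iff_ofReal
    (Eventually.of_forall hθ0)).2 (hlint.trans_lt ENNReal.ofReal_lt_top)⟩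
  have hχ1 : χ.1 1 = 1 := by
    change 1 - smoothCutoff (1 / 4) (q 1) = 1
    rw [smoothCutoff_eq_zero (by norm_num) (by rw [hq.apply_self]; norm_num), sub_zero]
  have hBχ : B χ ≤ 0 := hB χ (fun g ↦ by
    rw [hχ1]
    exact sub_le_self 1 (hθ0 g)) (by rw [hχ1]; exact zero_le_one)
  have hc : ∫ g, θ g ∂μ ≤ -B χ := by
    rw [integral_eq_lintegral_of_nonneg_ae (Eventually.of_forall hθ0) hθm]
    exact ENNReal.toReal_le_of_le_ofReal (neg_nonneg.2 hBχ) hlint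
  have hqi : Integrable q μ := integrable_of_gaugeMeasure hq hμi hθi
  have hint {f : G → ℝ} (hf : f ∈ smoothCompactlySupported E G) {C : ℝ}
      (hC : ∀ g, |f g| ≤ C * q g) : Integrable f μ := hμi f C hf.1.continuous hf.2 hC
  let X (i : Fin d) : smoothCompactlySupported E G := ⟨x i, hx.mem_smooth i⟩
  let XX (j k : Fin d) : smoothCompactlySupported E G :=
    smoothCompactlySupported.mulLeft (x j) (hx.mem_smooth j).1 (X k)
  have hxq (i : Fin d) (g : G) : |x i g| ≤ √(q g) :=
    (abs_le_sqrt_sum_sq (fun i ↦ x i g) i).trans (Real.sqrt_le_sqrt (hle g))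
  have hXXi (j k : Fin d) : Integrable (XX j k).1 μ := by
    refine hint (XX j k).2 (C := 1) fun g ↦ ?_
    change |x j g * x k g| ≤ _
    rw [abs_mul, one_mul, ← Real.mul_self_sqrt (hq.nonneg g)]
    exact mul_le_mul (hxq j g) (hxq k g) (abs_nonneg _) (Real.sqrt_nonneg _)
  let a : Matrix (Fin d) (Fin d) ℝ := fun j k ↦ (B (XX j k) - ∫ g, (XX j k).1 g ∂μ) / 2
  have ha : a.PosSemidef := by
    refine Matrix.PosSemidef.of_dotProduct_mulVec_nonneg ?_ fun v ↦ ?_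
    · ext j k
      have hs : XX k j = XX j k := by
        ext g
        exact mul_comm _ _
      change (B (XX k j) - ∫ g, (XX k j).1 g ∂μ) / 2 = (B (XX j k) - ∫ g, (XX j k).1 g ∂μ) / 2
      rw [hs]
    · let S : smoothCompactlySupported E G := ∑ j, ∑ k, (v j * v k) • XX j k
      have hS (g : G) : S.1 g = ∑ j, ∑ k, v j * v k * (XX j k).1 g := by
        simp [S, Finset.sum_apply]
      have hS2 (g : G) : S.1 g = (∑ j, v j * x j g) ^ 2 := by
        rw [hS, sq, Finset.sum_mul_sum]
        refine Finset.sum_congr rfl fun j _ ↦ Finset.sum_congr rfl fun k _ ↦ ?_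
        change v j * v k * (x j g * x k g) = _
        ring
      have hSeq : S.1 = fun g ↦ ∑ j, ∑ k, v j * v k * (XX j k).1 g := funext hS
      have hSi : Integrable S.1 μ := by
        rw [hSeq]
        exact integrable_finsetSum _ fun j _ ↦ integrable_finsetSum _ fun k _ ↦
          (hXXi j k).const_mul _
      have hSI : ∫ g, S.1 g ∂μ = ∑ j, ∑ k, v j * v k * ∫ g, (XX j k).1 g ∂μ := by
        rw [hSeq, integral_finsetSum _ fun j _ ↦ integrable_finsetSum _ fun k _ ↦
          (hXXi j k).const_mul _]
        refine Finset.sum_congr rfl fun j _ ↦ ?_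
        rw [integral_finsetSum _ fun k _ ↦ (hXXi j k).const_mul _]
        exact Finset.sum_congr rfl fun k _ ↦ integral_const_mul _ _
      have hSB : B S = ∑ j, ∑ k, v j * v k * B (XX j k) := by
        simp [S, map_sum, map_smul]
      have key := integral_le_of_gaugeMeasure hq hB hμ hμB hSi
        (fun g ↦ by rw [hS2]; positivity) (by rw [hS2]; simp [hx.map_one])
      have e : star v ⬝ᵥ a.mulVec v = (B S - ∫ g, S.1 g ∂μ) / 2 := by
        rw [hSB, hSI, ← Finset.sum_sub_distrib, Finset.sum_div]
        simp only [dotProduct, Matrix.mulVec, Pi.star_apply, star_trivial, Finset.mul_sum, a]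
        refine Finset.sum_congr rfl fun j _ ↦ ?_
        rw [← Finset.sum_sub_distrib, Finset.sum_div]
        exact Finset.sum_congr rfl fun k _ ↦ by ring
      rw [e]
      linarith
  refine ⟨-B χ - ∫ g, θ g ∂μ, fun i ↦ B (X i), a, μ, by linarith, ha,
    hx.isLevyMeasure hq hle hU hμ hqi, fun f ↦ ?_⟩
  set D : Fin d → ℝ := fun i ↦ leftInvariantDeriv (Y i) f.1 1
  set H : Fin d → Fin d → ℝ :=
    fun j k ↦ leftInvariantDeriv (Y j) (leftInvariantDeriv (Y k) f.1) 1
  let R : smoothCompactlySupported E G :=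
    f - f.1 1 • χ - ∑ i, D i • X i - ∑ j, ∑ k, (H j k / 2) • XX j k
  have hR (g : G) : R.1 g = f.1 g - f.1 1 * (1 - θ g) - ∑ i, x i g * D i
      - ∑ j, ∑ k, H j k / 2 * (XX j k).1 g := by
    simp only [R, Submodule.coe_sub, Submodule.coe_smul, Submodule.coe_sum, Pi.sub_apply,
      Finset.sum_apply, Pi.smul_apply, smul_eq_mul]
    congr 2
    exact Finset.sum_congr rfl fun i _ ↦ mul_comm _ _
  obtain ⟨C, hC0, hC⟩ := hx.exists_abs_taylor_le hq hle hU f.2 R.2 fun g ↦ by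
    rw [hR, Finset.sum_div]
    congr 1
    refine Finset.sum_congr rfl fun j _ ↦ ?_
    rw [Finset.sum_div]
    refine Finset.sum_congr rfl fun k _ ↦ ?_
    change H j k / 2 * (x j g * x k g) = x j g * x k g * H j k / 2
    ring
  obtain ⟨Q, hQ⟩ := hq.exists_le
  have hRi : Integrable R.1 μ := hint R.2 (C := C * √Q) fun g ↦ (hC g).trans <| by
    have := hq.nonneg g
    calc C * (q g * √(q g)) ≤ C * (q g * √Q) := by gcongr; exact hQ g
      _ = _ := by ring
  have hRB : B R = ∫ g, R.1 g ∂μ := eq_integral_of_gaugeMeasure hq hB hμ hμB hRi hC0 hC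
  have hBR : B R = B f - f.1 1 * B χ - ∑ i, D i * B (X i)
      - ∑ j, ∑ k, H j k / 2 * B (XX j k) := by
    simp [R, map_sub, map_sum, map_smul]
  have hsumi (j : Fin d) : Integrable (fun g ↦ ∑ k, H j k / 2 * (XX j k).1 g) μ :=
    integrable_finsetSum _ fun k _ ↦ (hXXi j k).const_mul _
  have hI : ∫ τ in {(1 : G)}ᶜ, (f.1 τ - f.1 1 - ∑ i, x i τ * D i) ∂μ
      = ∫ g, R.1 g ∂μ - f.1 1 * ∫ g, θ g ∂μ
        + ∑ j, ∑ k, H j k / 2 * ∫ g, (XX j k).1 g ∂μ := by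
    have hrestr : μ.restrict {(1 : G)}ᶜ = μ :=
      Measure.restrict_eq_self_of_ae_mem (measure_eq_zero_iff_ae_notMem.1 hμ)
    have hfun : (fun τ ↦ f.1 τ - f.1 1 - ∑ i, x i τ * D i)
        = fun g ↦ R.1 g - f.1 1 * θ g + ∑ j, ∑ k, H j k / 2 * (XX j k).1 g := by
      ext g
      rw [hR]
      ring
    have hRθ : Integrable (fun g ↦ R.1 g - f.1 1 * θ g) μ := hRi.sub (hθi.const_mul _)
    rw [hrestr, hfun, integral_add hRθ (integrable_finsetSum _ fun j _ ↦ hsumi j), integral_sub hRi (hθi.const_mul _),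
      integral_const_mul, integral_finsetSum _ fun j _ ↦ hsumi j]
    congr 1
    refine Finset.sum_congr rfl fun j _ ↦ ?_
    rw [integral_finsetSum _ fun k _ ↦ (hXXi j k).const_mul _]
    exact Finset.sum_congr rfl fun k _ ↦ integral_const_mul _ _
  have haH : ∑ j, ∑ k, a j k * H j k = ∑ j, ∑ k, H j k / 2 * B (XX j k)
      - ∑ j, ∑ k, H j k / 2 * ∫ g, (XX j k).1 g ∂μ := by
    rw [← Finset.sum_sub_distrib]
    refine Finset.sum_congr rfl fun j _ ↦ ?_
    rw [← Finset.sum_sub_distrib]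
    exact Finset.sum_congr rfl fun k _ ↦ by simp only [a]; ring
  have hbD : ∑ i, B (X i) * D i = ∑ i, D i * B (X i) :=
    Finset.sum_congr rfl fun i _ ↦ mul_comm _ _
  rw [hI, haH, hbD]
  linarith

/-- Left translation on `C_c^∞(G)`. -/
def smoothCompactlySupported.compMulLeft (σ : G) :
    smoothCompactlySupported E G →ₗ[ℝ] smoothCompactlySupported E G where
  toFun f := ⟨fun g ↦ f.1 (σ * g), f.2.1.comp contMDiff_mul_left, by
    have : ContinuousMul G := continuousMul_of_contMDiffMul 𝓘(ℝ, E) ∞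
    exact f.2.2.comp_homeomorph (Homeomorph.mulLeft σ)⟩
  map_add' _ _ := rfl
  map_smul' _ _ := rfl

theorem IsCanonicalCoordinates.exists_representation (hx : IsCanonicalCoordinates Y U x)
    {A : smoothCompactlySupported E G →ₗ[ℝ] (G → ℝ)} (hA : PositiveMaximumPrinciple A) (σ : G) :
    ∃ (c : ℝ) (b : Fin d → ℝ) (a : Matrix (Fin d) (Fin d) ℝ) (μ : Measure G),
      0 ≤ c ∧ a.PosSemidef ∧ IsLevyMeasure Y μ ∧ ∀ f : smoothCompactlySupported E G,
        A f σ = -c * f.1 σ + ∑ i, b i * leftInvariantDeriv (Y i) f.1 σ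
          + ∑ j, ∑ k, a j k * leftInvariantDeriv (Y j) (leftInvariantDeriv (Y k) f.1) σ
          + ∫ τ in {(1 : G)}ᶜ,
              (f.1 (σ * τ) - f.1 σ - ∑ i, x i τ * leftInvariantDeriv (Y i) f.1 σ) ∂μ := by
  obtain ⟨c, b, a, μ, hc, ha, hμ, h⟩ := hx.exists_representation_at_one
    (B := LinearMap.proj σ ∘ₗ A ∘ₗ smoothCompactlySupported.compMulLeft σ⁻¹) fun f hf h0 ↦ by
      have e : (smoothCompactlySupported.compMulLeft σ⁻¹ f).1 σ = f.1 1 :=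
        congrArg f.1 (inv_mul_cancel σ)
      refine hA (smoothCompactlySupported.compMulLeft σ⁻¹ f) σ (fun g ↦ ?_) ?_
      · rw [e]
        exact hf _
      · rwa [e]
  refine ⟨c, b, a, μ, hc, ha, hμ, fun f ↦ ?_⟩
  have h1 := h (smoothCompactlySupported.compMulLeft σ f)
  have e1 : smoothCompactlySupported.compMulLeft σ⁻¹ (smoothCompactlySupported.compMulLeft σ f)
      = f := by
    ext g
    exact congrArg f.1 (mul_inv_cancel_left σ g)
  have e2 (v : GroupLieAlgebra 𝓘(ℝ, E) G) :
      leftInvariantDeriv v (smoothCompactlySupported.compMulLeft σ f).1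
        = fun τ ↦ leftInvariantDeriv v f.1 (σ * τ) :=
    funext fun τ ↦ leftInvariantDeriv_comp_mul_left v f.2.1 σ τ
  have e3 (τ : G) : (smoothCompactlySupported.compMulLeft σ f).1 τ = f.1 (σ * τ) := rfl
  have e4 (v w : GroupLieAlgebra 𝓘(ℝ, E) G) (τ : G) :
      leftInvariantDeriv v (fun τ ↦ leftInvariantDeriv w f.1 (σ * τ)) τ
        = leftInvariantDeriv v (leftInvariantDeriv w f.1) (σ * τ) :=
    leftInvariantDeriv_comp_mul_left v (contMDiff_leftInvariantDeriv w f.2.1) σ τ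
  simp only [LinearMap.comp_apply, e1, e2, e3, e4, mul_one, LinearMap.proj_apply] at h1
  exact h1

end Representation

theorem mainTheorem3 {E : Type*} [NormedAddCommGroup E] [NormedSpace ℝ E] [FiniteDimensional ℝ E]
    {G : Type*} [TopologicalSpace G] [T2Space G] [SecondCountableTopology G]
    [ChartedSpace E G] [Group G] [LieGroup 𝓘(ℝ, E) ∞ G] [MeasurableSpace G] [BorelSpace G]
    {d : ℕ} (Y : Module.Basis (Fin d) ℝ (GroupLieAlgebra 𝓘(ℝ, E) G))
    (U : Set G) (x : Fin d → G → ℝ) (hx : IsCanonicalCoordinates Y U x)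
    (A : smoothCompactlySupported E G →ₗ[ℝ] (G → ℝ)) :
    PositiveMaximumPrinciple A ↔
      ∃ (c : G → ℝ) (b : Fin d → G → ℝ) (a : G → Matrix (Fin d) (Fin d) ℝ) (μ : G → Measure G),
        (∀ σ, 0 ≤ c σ) ∧ (∀ σ, (a σ).PosSemidef) ∧ IsLevyKernel Y μ ∧
        ∀ (f : smoothCompactlySupported E G) (σ : G),
          A f σ = -c σ * f.1 σ + ∑ i, b i σ * leftInvariantDeriv (Y i) f.1 σ
            + ∑ j, ∑ k, a σ j k * leftInvariantDeriv (Y j) (leftInvariantDeriv (Y k) f.1) σ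
            + ∫ τ in {(1 : G)}ᶜ,
                (f.1 (σ * τ) - f.1 σ - ∑ i, x i τ * leftInvariantDeriv (Y i) f.1 σ) ∂(μ σ) := by
  constructor
  · intro hA
    choose c b a μ hc ha hμ h using hx.exists_representation hA
    exact ⟨c, fun i σ ↦ b σ i, a, μ, hc, ha, hμ, fun f σ ↦ h σ f⟩
  · rintro ⟨c, b, a, μ, hc, ha, -, h⟩ f σ hmax h0
    have : CompleteSpace E := FiniteDimensional.complete ℝ E
    have hD (v) : leftInvariantDeriv v f.1 σ = 0 :=
      leftInvariantDeriv_eq_zero_of_isMax f.2.1 hmax v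
    have h2 := sum_posSemidef_mul_nonpos
      (H := fun j k ↦ leftInvariantDeriv (Y j) (leftInvariantDeriv (Y k) f.1) σ) (ha σ)
      (sum_leftInvariantDeriv_nonpos_of_isMax Y f.2.1 hmax)
    have h3 : ∫ τ in {(1 : G)}ᶜ, (f.1 (σ * τ) - f.1 σ) ∂(μ σ) ≤ 0 :=
      integral_nonpos fun τ ↦ sub_nonpos.2 (hmax _)
    have h4 := mul_nonneg (hc σ) h0
    rw [h f σ]
    simp only [hD, mul_zero, Finset.sum_const_zero, sub_zero]
    linarith
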